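/- For a finite connected simple graph $G$, let its Wiener index $W(G)=\sum_{\{u,v\}\subset V(G)} d(u,v)$ be the sum of the distances over all unordered pairs of distinct vertices, and let its diameter be $\max_{u,v} d(u,v)$. Write $W_{n,d}$ for the maximum Wiener index of a graph of order $n$ and diameter $d$ (for each $d\ge 1$ such graphs exist whenever $n>d$). Then $$\liminf_{d \to \infty} \liminf_{n \to \infty} \frac{\frac d2 n^2 - W_{n,d}}{d^{3/2} n^{3/2}} \ \ge\ \frac{1}{2 \sqrt{24}} \ >\ 0.1$$ and $$\limsup_{d \to \infty} \limsup_{n \to \infty} \frac{\frac d2 n^2 - W_{n,d}}{d^{3/2} n^{3/2}} \ <\ \frac{29}{60}.$$ -/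

import Mathlib

open Filter

/-- The Wiener index (total distance) of a finite simple graph: the sum of the distances over all
unordered pairs `{u, v}` of distinct vertices. -/
noncomputable def SimpleGraph.wienerIndex {V : Type*} [Fintype V] [DecidableEq V] (G : SimpleGraph V) : ℕ :=
  ∑ e : Sym2 V with ¬ e.IsDiag, Sym2.lift ⟨fun u v => G.dist u v, fun _ _ => G.dist_comm⟩ e

/-- The Wiener indices of the graphs of order `n` and (finite) diameter `d`. -/
def wienerValues (n d : ℕ) : Set ℕ :=
  {w | ∃ G : SimpleGraph (Fin n), G.Connected ∧ G.diam = d ∧ G.wienerIndex = w}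

/-- The maximum Wiener index of a graph of order `n` and diameter `d`
(a maximum as soon as such a graph exists, see `isGreatest_maxWiener`; otherwise `0`). -/
noncomputable def maxWiener (n d : ℕ) : ℕ := sSup (wienerValues n d)

theorem wienerValues_finite (n d : ℕ) : (wienerValues n d).Finite := by
  refine (Set.finite_range fun G : SimpleGraph (Fin n) => G.wienerIndex).subset ?_
  rintro w ⟨G, -, -, rfl⟩
  exact ⟨G, rfl⟩

theorem isGreatest_maxWiener {n d : ℕ} (h : (wienerValues n d).Nonempty) :
    IsGreatest (wienerValues n d) (maxWiener n d) :=
  ⟨Nat.sSup_mem h (wienerValues_finite n d).bddAbove,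
    fun _ hw => le_csSup (wienerValues_finite n d).bddAbove hw⟩

/-- The normalized gap `((d/2) n² - W_{n,d}) / (d^{3/2} n^{3/2})`. -/
noncomputable def wienerGap (n d : ℕ) : ℝ :=
  ((d : ℝ) / 2 * (n : ℝ) ^ 2 - (maxWiener n d : ℝ)) /
    ((d : ℝ) ^ (3 / 2 : ℝ) * (n : ℝ) ^ (3 / 2 : ℝ))

/-!
Write `T` for the sum of `d - dist u v` over all ordered pairs, so that `T = d * n ^ 2 - 2 * W` and
the normalized gap is `T / (2 * d ^ (3/2) * n ^ (3/2))`. Write `S v` for the part of `T` with first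
vertex `v`.

**Lower bound on the gap.** Give the pair `x, v` the weight `g = max (d - 2 * dist x v) 0`. Two
estimates are combined in a double count of `∑ x, ∑ v, g * S x / S v`.
* For fixed `x`, the vertices `v` of positive weight are near `x`, hence near each other, and so
  have large deficits `S v`. By the triangle inequality and concavity, `∑ v, g / S v ≤ 1`
  (`SimpleGraph.sum_weight_div_deficit_le_one`). The double sum is thus at most `T`.
* For fixed `v`, almost every vertex `w` is far from `v`, and the vertex `x` at distance `i` from
  `v` on a geodesic to `w` satisfies `dist x w ≤ d - i`. Summing over `i` and `w` gives
  `∑ x, g * S x ≥ c * (n - 2 * S v / d)`, where `c = ∑ i * (d - 2 * i)` is about `d ^ 3 / 24`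
  (`SimpleGraph.geodesicConst_mul_le_sum_weight_mul_deficit`).

With the Cauchy-Schwarz bound `∑ 1 / S v ≥ n ^ 2 / T` this yields
`c * n ^ 3 ≤ T * (T + 2 * c * n / d)` (`SimpleGraph.geodesicConst_mul_card_pow_le`). As `n` grows,
`T` is at least about `√c * n ^ (3/2)`, and `√c / (2 * d ^ (3/2))` tends to `1 / (2 * √24)`.

**Upper bound on the gap.** A spider with `k` legs of length about `d / 2` and its remaining
vertices distributed evenly over the ends of the legs loses `d * n ^ 2 / k` on pairs at the same
leg, and about `k * n * d ^ 2 / 4` on pairs containing a vertex inside a leg. With the best `k`, of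
order `√(n / d)`, its gap tends to `1 / 2`, which is not good enough. Forking each leg at distance
`d / 6` from its end balances the two losses better: `T` is then about
`5 / 6 * d * n ^ 2 / k + 5 / 18 * d ^ 2 * n * k` (`ForkedSpider.totalDeficit_le`), and for
`k = 7 / 4 * √(n / d)` the gap tends to about `0.4812 < 29 / 60`. For odd `d` the central ends of
the legs are made pairwise adjacent, so that vertices at different legs are still at distance
exactly `d`: a loss of even one unit for a positive proportion of all pairs would exceed
`n ^ (3/2)`. Distances from a leaf are bounded below by an explicit function that changes by at
most one along each edge (`ForkedSpider.distFromLeaf`).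
-/

open Topology

/-! ### The distance deficit -/

namespace SimpleGraph

variable {V : Type*}

/-- The deficit of the vertex `v` with respect to `d`: the sum of `d - dist v u` over all vertices
`u`. The vertex `u = v` is included and contributes `d`. -/
noncomputable def deficit [Fintype V] (G : SimpleGraph V) (d : ℕ) (v : V) : ℝ :=
  ∑ u, ((d : ℝ) - G.dist v u)

/-- The sum of `d - dist v u` over all ordered pairs `(v, u)`, including those with `v = u`. -/
noncomputable def totalDeficit [Fintype V] (G : SimpleGraph V) (d : ℕ) : ℝ :=
  ∑ v, G.deficit d v

theorem sum_sum_dist_eq_two_mul_wienerIndex {n : ℕ} (G : SimpleGraph (Fin n)) :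
    ∑ u, ∑ v, G.dist u v = 2 * G.wienerIndex := by
  have h1 : G.wienerIndex =
      ∑ i ∈ (Finset.univ : Finset (Fin n)).offDiag with i.1 < i.2, G.dist i.1 i.2 := by
    unfold wienerIndex
    rw [← Finset.sym2_univ, Finset.sum_sym2_filter_not_isDiag]
    rfl
  have h2 : G.wienerIndex =
      ∑ i ∈ (Finset.univ : Finset (Fin n)).offDiag with ¬ i.1 < i.2, G.dist i.1 i.2 := by
    rw [h1]
    refine Finset.sum_bij (fun i _ => (i.2, i.1)) ?_ ?_ ?_ ?_
    · rintro ⟨a, b⟩ h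
      simp only [Finset.mem_filter, Finset.mem_offDiag, Finset.mem_univ, true_and] at h ⊢
      exact ⟨h.1.symm, by omega⟩
    · rintro ⟨a, b⟩ _ ⟨a', b'⟩ _ h
      simp only [Prod.mk.injEq] at h ⊢
      exact h.symm
    · rintro ⟨a, b⟩ h
      simp only [Finset.mem_filter, Finset.mem_offDiag, Finset.mem_univ, true_and] at h
      refine ⟨(b, a), ?_, rfl⟩
      simp only [Finset.mem_filter, Finset.mem_offDiag, Finset.mem_univ, true_and]
      exact ⟨h.1.symm, by omega⟩
    · rintro ⟨a, b⟩ _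
      exact G.dist_comm
  have h3 : ∑ u, ∑ v, G.dist u v
      = ∑ i ∈ (Finset.univ : Finset (Fin n)).offDiag, G.dist i.1 i.2 := by
    rw [← Fintype.sum_prod_type']
    refine (Finset.sum_subset (Finset.subset_univ _) ?_).symm
    rintro ⟨a, b⟩ _ h
    simp only [Finset.mem_offDiag, Finset.mem_univ, true_and, not_not] at h
    simp [h]
  rw [h3, ← Finset.sum_filter_add_sum_filter_not _ (fun i : Fin n × Fin n => i.1 < i.2),
    ← h1, ← h2, two_mul]

theorem totalDeficit_eq_sub_wienerIndex {n : ℕ} (G : SimpleGraph (Fin n)) (d : ℕ) :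
    G.totalDeficit d = d * (n : ℝ) ^ 2 - 2 * G.wienerIndex := by
  have h : (∑ u, ∑ v, (G.dist u v : ℝ)) = 2 * G.wienerIndex := by
    exact_mod_cast G.sum_sum_dist_eq_two_mul_wienerIndex
  simp only [totalDeficit, deficit, Finset.sum_sub_distrib, h, Finset.sum_const,
    Finset.card_univ, Fintype.card_fin, nsmul_eq_mul]
  ring

/-! ### Every graph has a large deficit -/

theorem Connected.exists_dist_eq_and_add_dist_eq {G : SimpleGraph V}
    (hG : G.Connected) (v w : V) {i : ℕ} (hi : i ≤ G.dist v w) :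
    ∃ x, G.dist v x = i ∧ i + G.dist x w = G.dist v w := by
  obtain ⟨p, hp⟩ := hG.exists_walk_length_eq_dist v w
  have h1 := dist_le (p.take i)
  have h2 := dist_le (p.drop i)
  have h3 := hG.dist_triangle (u := v) (v := p.getVert i) (w := w)
  simp only [Walk.take_length, Walk.drop_length] at h1 h2
  exact ⟨p.getVert i, by omega, by omega⟩

/-- The weight `max (d - 2 dist x v) 0`. It is concentrated on the ball of radius `d / 2`
around `x`. -/
noncomputable def weight (G : SimpleGraph V) (d : ℕ) (x v : V) : ℝ :=
  max ((d : ℝ) - 2 * G.dist x v) 0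

theorem weight_nonneg (G : SimpleGraph V) (d : ℕ) (x v : V) : 0 ≤ G.weight d x v :=
  le_max_right _ _

theorem weight_comm (G : SimpleGraph V) (d : ℕ) (x v : V) :
    G.weight d x v = G.weight d v x := by
  simp [weight, G.dist_comm]

/-- The sum of `i (d - 2 i)` over `0 ≤ i ≤ d / 2`. This is what a geodesic leaving `v` contributes
to `∑ x, weight d v x * deficit d x` for each endpoint at distance at least `d / 2` from `v`. -/
noncomputable def geodesicConst (d : ℕ) : ℝ :=
  ∑ i ∈ Finset.range (d / 2 + 1), (i : ℝ) * ((d : ℝ) - 2 * i)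

theorem geodesicConst_ge (d : ℕ) : ((d : ℝ) ^ 3 - 4 * d) / 24 ≤ geodesicConst d := by
  have key : ∀ (a : ℝ) (m : ℕ), ∑ i ∈ Finset.range (m + 1), (i : ℝ) * (a - 2 * i)
      = a * (m * (m + 1) / 2) - m * (m + 1) * (2 * m + 1) / 3 := by
    intro a m
    induction m with
    | zero => simp
    | succ m ih => rw [Finset.sum_range_succ, ih]; push_cast; ring
  rw [geodesicConst, key]
  rcases Nat.even_or_odd' d with ⟨m, rfl | rfl⟩
  · have : 2 * m / 2 = m := by omega
    rw [this]; push_cast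
    nlinarith
  · have : (2 * m + 1) / 2 = m := by omega
    rw [this]; push_cast
    have : (0 : ℝ) ≤ m := by positivity
    nlinarith

theorem geodesicConst_le (d : ℕ) : geodesicConst d ≤ (d : ℝ) ^ 3 := by
  have : geodesicConst d ≤ ∑ i ∈ Finset.range (d / 2 + 1), (d : ℝ) / 2 * d := by
    refine Finset.sum_le_sum fun i hi => ?_
    have hi : i ≤ d / 2 := by simpa [Nat.lt_succ_iff] using hi
    have h2 : (2 * i : ℝ) ≤ d := by exact_mod_cast (by omega : 2 * i ≤ d)
    have h0 : (0 : ℝ) ≤ i := by positivity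
    nlinarith
  refine this.trans ?_
  rcases Nat.eq_zero_or_pos d with rfl | hd
  · simp
  have h1 : ((d / 2 + 1 : ℕ) : ℝ) ≤ 2 * d := by exact_mod_cast (by omega : d / 2 + 1 ≤ 2 * d)
  rw [Finset.sum_const, Finset.card_range, nsmul_eq_mul]
  have h0 : (0 : ℝ) ≤ (d : ℝ) / 2 * d := by positivity
  nlinarith [mul_le_mul_of_nonneg_right h1 h0]

theorem geodesicConst_nonneg (d : ℕ) : 0 ≤ geodesicConst d := by
  refine Finset.sum_nonneg fun i hi => ?_
  have hi : i ≤ d / 2 := by simpa [Nat.lt_succ_iff] using hi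
  have h2 : (2 * i : ℝ) ≤ d := by exact_mod_cast (by omega : 2 * i ≤ d)
  exact mul_nonneg (by positivity) (by linarith)

/-- A concavity estimate: if `S v ≥ ∑ u ∈ P, (g v + g u) / 2` for all `v ∈ P`, then the numbers
`g v / S v` add up to at most one. The extremal case is that of constant `g`. -/
theorem sum_div_le_one_of_card_mul_add_sum_le {ι : Type*} (P : Finset ι) (g S : ι → ℝ)
    (hg : ∀ v ∈ P, 0 < g v)
    (hS : ∀ v ∈ P, (P.card * g v + ∑ u ∈ P, g u) / 2 ≤ S v) :
    ∑ v ∈ P, g v / S v ≤ 1 := by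
  rcases P.eq_empty_or_nonempty with rfl | hP
  · simp
  set Γ := ∑ u ∈ P, g u with hΓ
  have hΓ0 : 0 < Γ := Finset.sum_pos hg hP
  have hp : (0 : ℝ) < P.card := by exact_mod_cast hP.card_pos
  -- The tangent line of `t ↦ 2 t / (p t + Γ)` at the mean value `t = Γ / p`.
  have key : ∀ v ∈ P, g v / S v ≤ (1 / P.card + g v / Γ) / 2 := by
    intro v hv
    have h0 := hg v hv
    have h1 : 0 < (P.card * g v + Γ) / 2 := by positivity
    calc g v / S v ≤ g v / ((P.card * g v + Γ) / 2) :=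
          div_le_div_of_nonneg_left h0.le h1 (hS v hv)
      _ ≤ (1 / P.card + g v / Γ) / 2 := by
          rw [div_add_div _ _ hp.ne' hΓ0.ne', div_div, div_le_div_iff₀ h1 (by positivity)]
          nlinarith [sq_nonneg ((P.card : ℝ) * g v - Γ)]
  refine (Finset.sum_le_sum key).trans ?_
  rw [← Finset.sum_div, Finset.sum_add_distrib, ← Finset.sum_div _ g, ← hΓ, Finset.sum_const,
    nsmul_eq_mul, mul_one_div_cancel hp.ne', div_self hΓ0.ne']
  norm_num

variable [Fintype V]

theorem deficit_pos {G : SimpleGraph V} {d : ℕ} (hd : 0 < d) (hdist : ∀ u v, G.dist u v ≤ d)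
    (v : V) : 0 < G.deficit d v := by
  refine Finset.sum_pos' (fun u _ => ?_) ⟨v, Finset.mem_univ _, ?_⟩
  · exact sub_nonneg.2 (by exact_mod_cast hdist v u)
  · simpa using hd

/-- Two vertices of the ball of radius `d / 2` around `x` are close to each other, so each of them
has a large deficit; hence the weights around `x`, measured against the deficits, sum to at most
one. -/
theorem sum_weight_div_deficit_le_one {G : SimpleGraph V} (hG : G.Connected) {d : ℕ}
    (hdist : ∀ u v, G.dist u v ≤ d) (x : V) :
    ∑ v, G.weight d x v / G.deficit d v ≤ 1 := by
  classical
  set P : Finset V := Finset.univ.filter fun v => 0 < G.weight d x v with hP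
  have h1 : ∑ v ∈ P, G.weight d x v / G.deficit d v = ∑ v, G.weight d x v / G.deficit d v := by
    refine Finset.sum_subset (Finset.subset_univ _) fun v _ hv => ?_
    have : G.weight d x v = 0 := by
      simp only [hP, Finset.mem_filter, Finset.mem_univ, true_and, not_lt] at hv
      exact le_antisymm hv (G.weight_nonneg d x v)
    simp [this]
  rw [← h1]
  have hw : ∀ v ∈ P, G.weight d x v = (d : ℝ) - 2 * G.dist x v := by
    intro v hv
    simp only [hP, Finset.mem_filter, Finset.mem_univ, true_and] at hv
    refine max_eq_left ?_
    by_contra h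
    rw [weight, max_eq_right (not_le.1 h).le] at hv
    exact lt_irrefl _ hv
  refine sum_div_le_one_of_card_mul_add_sum_le P _ _ (fun v hv => by simpa [hP] using hv) ?_
  intro v hv
  calc (P.card * G.weight d x v + ∑ u ∈ P, G.weight d x u) / 2
      = ∑ u ∈ P, (G.weight d x v + G.weight d x u) / 2 := by
        rw [← Finset.sum_div, Finset.sum_add_distrib, Finset.sum_const, nsmul_eq_mul]
    _ ≤ ∑ u ∈ P, ((d : ℝ) - G.dist v u) := by
        refine Finset.sum_le_sum fun u hu => ?_
        have h3 : (G.dist v u : ℝ) ≤ G.dist x v + G.dist x u := by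
          have := hG.dist_triangle (u := v) (v := x) (w := u)
          rw [G.dist_comm (u := v) (v := x)] at this
          exact_mod_cast this
        rw [hw v hv, hw u hu]
        linarith
    _ ≤ G.deficit d v := by
        refine Finset.sum_le_sum_of_subset_of_nonneg (Finset.subset_univ _) fun u _ _ => ?_
        exact sub_nonneg.2 (by exact_mod_cast hdist v u)

theorem geodesicConst_le_sum_weight_mul {G : SimpleGraph V} (hG : G.Connected) {d : ℕ}
    (hdist : ∀ u v, G.dist u v ≤ d) {v w : V} (hvw : d ≤ 2 * G.dist v w) :
    geodesicConst d ≤ ∑ x, G.weight d v x * ((d : ℝ) - G.dist x w) := by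
  classical
  have hex : ∀ i : ℕ, ∃ x, i ≤ d / 2 → G.dist v x = i ∧ i + G.dist x w = G.dist v w := by
    intro i
    by_cases hi : i ≤ d / 2
    · obtain ⟨x, hx⟩ := hG.exists_dist_eq_and_add_dist_eq v w (i := i) (by omega)
      exact ⟨x, fun _ => hx⟩
    · exact ⟨v, fun h => absurd h hi⟩
  choose x hx using hex
  have hinj : Set.InjOn x (Finset.range (d / 2 + 1) : Set ℕ) := by
    intro i hi j hj hij
    simp only [Finset.coe_range, Set.mem_Iio, Nat.lt_succ_iff] at hi hj
    rw [← (hx i hi).1, ← (hx j hj).1, hij]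
  calc
    geodesicConst d
      ≤ ∑ i ∈ Finset.range (d / 2 + 1), G.weight d v (x i) * ((d : ℝ) - G.dist (x i) w) := by
        refine Finset.sum_le_sum fun i hi => ?_
        have hi : i ≤ d / 2 := by simpa [Nat.lt_succ_iff] using hi
        obtain ⟨h1, h2⟩ := hx i hi
        have h3 : (i : ℝ) + G.dist (x i) w ≤ d := by
          have h := h2.trans_le (hdist v w)
          exact_mod_cast h
        have h4 : (d : ℝ) - 2 * i ≤ G.weight d v (x i) := by
          rw [weight, h1]; exact le_max_left _ _
        have h5 : (i : ℝ) ≤ d - G.dist (x i) w := by linarith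
        rw [mul_comm]
        exact mul_le_mul h4 h5 (by positivity) (G.weight_nonneg _ _ _)
    _ = ∑ y ∈ (Finset.range (d / 2 + 1)).image x, G.weight d v y * ((d : ℝ) - G.dist y w) := by
        rw [Finset.sum_image hinj]
    _ ≤ ∑ y, G.weight d v y * ((d : ℝ) - G.dist y w) := by
        refine Finset.sum_le_sum_of_subset_of_nonneg (Finset.subset_univ _) fun y _ _ => ?_
        exact mul_nonneg (G.weight_nonneg _ _ _) (sub_nonneg.2 (by exact_mod_cast hdist y w))

/-- All but `2 * deficit d v / d` vertices lie at distance at least `d / 2` from `v`, and geodesics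
from `v` to these pass through vertices near `v` of large deficit. -/
theorem geodesicConst_mul_le_sum_weight_mul_deficit {G : SimpleGraph V} (hG : G.Connected) {d : ℕ}
    (hd : 0 < d) (hdist : ∀ u v, G.dist u v ≤ d) (v : V) :
    geodesicConst d * (Fintype.card V - 2 * G.deficit d v / d) ≤
      ∑ x, G.weight d v x * G.deficit d x := by
  classical
  have hd' : (0 : ℝ) < d := by exact_mod_cast hd
  have hnn : ∀ x w, (0 : ℝ) ≤ (d : ℝ) - G.dist x w := fun x w =>
    sub_nonneg.2 (by exact_mod_cast hdist x w)
  set F : Finset V := Finset.univ.filter fun w => d ≤ 2 * G.dist v w with hF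
  have hcard : (Fintype.card V : ℝ) - 2 * G.deficit d v / d ≤ F.card := by
    have h1 : ((Fᶜ.card : ℕ) : ℝ) * (d / 2) ≤ G.deficit d v := by
      calc ((Fᶜ.card : ℕ) : ℝ) * (d / 2) = ∑ w ∈ Fᶜ, (d : ℝ) / 2 := by
            rw [Finset.sum_const, nsmul_eq_mul]
        _ ≤ ∑ w ∈ Fᶜ, ((d : ℝ) - G.dist v w) := by
            refine Finset.sum_le_sum fun w hw => ?_
            have : 2 * G.dist v w ≤ d := by
              simp only [hF, Finset.mem_compl, Finset.mem_filter, Finset.mem_univ, true_and,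
                not_le] at hw
              exact hw.le
            have : (2 : ℝ) * G.dist v w ≤ d := by exact_mod_cast this
            linarith
        _ ≤ G.deficit d v :=
            Finset.sum_le_sum_of_subset_of_nonneg (Finset.subset_univ _) fun w _ _ => hnn v w
    have h2 : (F.card : ℝ) + Fᶜ.card = Fintype.card V := by
      exact_mod_cast Finset.card_add_card_compl F
    have h3 : ((Fᶜ.card : ℕ) : ℝ) ≤ 2 * G.deficit d v / d := by
      rw [le_div_iff₀ hd']; linarith
    linarith
  calc geodesicConst d * (Fintype.card V - 2 * G.deficit d v / d)
      ≤ geodesicConst d * F.card := mul_le_mul_of_nonneg_left hcard (geodesicConst_nonneg d)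
    _ = ∑ w ∈ F, geodesicConst d := by rw [Finset.sum_const, nsmul_eq_mul, mul_comm]
    _ ≤ ∑ w ∈ F, ∑ x, G.weight d v x * ((d : ℝ) - G.dist x w) := by
        refine Finset.sum_le_sum fun w hw => ?_
        exact geodesicConst_le_sum_weight_mul hG hdist (by simpa [hF] using hw)
    _ ≤ ∑ w, ∑ x, G.weight d v x * ((d : ℝ) - G.dist x w) := by
        refine Finset.sum_le_sum_of_subset_of_nonneg (Finset.subset_univ _) fun w _ _ => ?_
        exact Finset.sum_nonneg fun x _ => mul_nonneg (G.weight_nonneg _ _ _) (hnn x w)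
    _ = ∑ x, G.weight d v x * G.deficit d x := by
        rw [Finset.sum_comm]
        simp only [deficit, Finset.mul_sum]

/-- Double counting `∑ x, ∑ v, weight d x v * deficit d x / deficit d v`. -/
theorem geodesicConst_mul_card_pow_le {G : SimpleGraph V} (hG : G.Connected) {d : ℕ}
    (hd : 0 < d) (hdist : ∀ u v, G.dist u v ≤ d) :
    geodesicConst d * (Fintype.card V : ℝ) ^ 3 ≤
      G.totalDeficit d *
        (G.totalDeficit d + 2 * geodesicConst d * Fintype.card V / d) := by
  set c := geodesicConst d
  set T := G.totalDeficit d with hT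
  set n : ℝ := (Fintype.card V : ℝ) with hn
  have hSpos := deficit_pos hd hdist
  have hnpos : 0 < n := by
    have := hG.nonempty
    exact Nat.cast_pos.2 Fintype.card_pos
  have hTpos : 0 < T := by
    have := hG.nonempty
    exact Finset.sum_pos (fun v _ => hSpos v) Finset.univ_nonempty
  have hc : 0 ≤ c := geodesicConst_nonneg d
  have h1 : ∑ v, c * (n - 2 * G.deficit d v / d) / G.deficit d v ≤ T := by
    calc ∑ v, c * (n - 2 * G.deficit d v / d) / G.deficit d v
        ≤ ∑ v, (∑ x, G.weight d v x * G.deficit d x) / G.deficit d v := by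
          refine Finset.sum_le_sum fun v _ => ?_
          exact div_le_div_of_nonneg_right
            (geodesicConst_mul_le_sum_weight_mul_deficit hG hd hdist v) (hSpos v).le
      _ = ∑ x, G.deficit d x * ∑ v, G.weight d x v / G.deficit d v := by
          simp only [Finset.sum_div, Finset.mul_sum]
          rw [Finset.sum_comm]
          refine Finset.sum_congr rfl fun x _ => Finset.sum_congr rfl fun v _ => ?_
          rw [G.weight_comm]; ring
      _ ≤ ∑ x, G.deficit d x * 1 := by
          refine Finset.sum_le_sum fun x _ => ?_
          exact mul_le_mul_of_nonneg_left (sum_weight_div_deficit_le_one hG hdist x) (hSpos x).le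
      _ = T := by simp [hT, totalDeficit]
  have h2 : ∑ v, c * (n - 2 * G.deficit d v / d) / G.deficit d v
      = c * n * (∑ v, (1 : ℝ) ^ 2 / G.deficit d v) - 2 * c * n / d := by
    have : ∀ v, c * (n - 2 * G.deficit d v / d) / G.deficit d v
        = c * n * ((1 : ℝ) ^ 2 / G.deficit d v) - 2 * c / d := by
      intro v
      have := (hSpos v).ne'
      field_simp
    simp only [this, Finset.sum_sub_distrib, ← Finset.mul_sum, Finset.sum_const, nsmul_eq_mul,
      Finset.card_univ, ← hn]
    ring
  have h3 : n ^ 2 / T ≤ ∑ v, (1 : ℝ) ^ 2 / G.deficit d v := by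
    have := Finset.sq_sum_div_le_sum_sq_div (Finset.univ : Finset V) (fun _ => (1 : ℝ))
      (g := fun v => G.deficit d v) (fun v _ => hSpos v)
    simpa [hT, totalDeficit, hn] using this
  have h4 : c * n * (n ^ 2 / T) ≤ T + 2 * c * n / d := by
    have := mul_le_mul_of_nonneg_left h3 (mul_nonneg hc hnpos.le)
    linarith
  have h5 := mul_le_mul_of_nonneg_left h4 hTpos.le
  calc c * n ^ 3 = T * (c * n * (n ^ 2 / T)) := by field_simp
    _ ≤ _ := h5

end SimpleGraph

/-! ### Lower bounds on distances -/

namespace SimpleGraph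

variable {V : Type*}

theorem Connected.le_add_dist_of_forall_adj {G : SimpleGraph V} (hG : G.Connected) {f : V → ℕ}
    (hf : ∀ u v, G.Adj u v → f v ≤ f u + 1) (u v : V) : f v ≤ f u + G.dist u v := by
  obtain ⟨p, hp⟩ := hG.exists_walk_length_eq_dist u v
  rw [← hp]
  clear hp
  induction p with
  | nil => simp
  | cons h p ih => have := hf _ _ h; rw [Walk.length_cons]; omega

theorem Iso.dist_eq {W : Type*} {G : SimpleGraph V} {H : SimpleGraph W} (hG : G.Connected)
    (e : G ≃g H) (u v : V) : H.dist (e u) (e v) = G.dist u v := by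
  have hH : H.Connected := e.connected_iff.1 hG
  apply le_antisymm
  · obtain ⟨p, hp⟩ := hG.exists_walk_length_eq_dist u v
    rw [← hp, ← p.length_map e.toHom]
    exact dist_le _
  · obtain ⟨p, hp⟩ := hH.exists_walk_length_eq_dist (e u) (e v)
    rw [← hp, ← p.length_map e.symm.toHom]
    simpa using dist_le ((p.map e.symm.toHom).copy (e.symm_apply_apply u) (e.symm_apply_apply v))

end SimpleGraph

theorem exists_mem_wienerValues_of_card_eq {V : Type*} [Fintype V] {n d : ℕ}
    (hn : Fintype.card V = n) (G : SimpleGraph V) (hG : G.Connected)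
    (hle : ∀ u v, G.dist u v ≤ d) (hex : ∃ u v, d ≤ G.dist u v) :
    ∃ w ∈ wienerValues n d, (d : ℝ) * (n : ℝ) ^ 2 - 2 * w = G.totalDeficit d := by
  let H := G.overFin hn
  let e : G ≃g H := G.overFinIso hn
  have hH : H.Connected := e.connected_iff.1 hG
  have : Nonempty (Fin n) := hH.nonempty
  have hdist := SimpleGraph.Iso.dist_eq hG e
  refine ⟨H.wienerIndex, ⟨H, hH, ?_, rfl⟩, ?_⟩
  · apply le_antisymm
    · obtain ⟨a, b, hab⟩ := H.exists_dist_eq_diam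
      rw [← hab, ← e.apply_symm_apply a, ← e.apply_symm_apply b, hdist]
      exact hle _ _
    · obtain ⟨u, v, huv⟩ := hex
      rw [← hdist] at huv
      exact huv.trans (SimpleGraph.dist_le_diam (SimpleGraph.connected_iff_ediam_ne_top.1 hH))
  · rw [← SimpleGraph.totalDeficit_eq_sub_wienerIndex]
    simp only [SimpleGraph.totalDeficit, SimpleGraph.deficit]
    rw [← e.toEquiv.sum_comp]
    refine Finset.sum_congr rfl fun u _ => ?_
    rw [← e.toEquiv.sum_comp]
    refine Finset.sum_congr rfl fun v _ => ?_
    have := hdist u v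
    simp only [RelIso.coe_fn_toEquiv]
    rw [this]

/-! ### The forked spider -/

namespace ForkedSpider

/-- The skeleton: a centre (`none`), and for each of `k` branches two arms of `s` vertices and a
trunk of `r` vertices. -/
abbrev Skeleton (k s r : ℕ) : Type := Option ((Fin k × Bool × Fin s) ⊕ (Fin k × Fin r))

/-- The vertices of the forked spider: the skeleton and `m` leaves. -/
abbrev Vertex (k s r m : ℕ) : Type := Skeleton k s r ⊕ Fin m

variable {k s r m : ℕ}

/-- The branch containing a vertex; the centre gets the junk value `0`. The leaves are
distributed cyclically over the `2 * k` arms. -/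
def branch : Vertex k s r m → ℕ
  | .inl none => 0
  | .inl (some (.inl (b, _, _))) => b
  | .inl (some (.inr (b, _))) => b
  | .inr l => (l % (2 * k)) / 2

/-- The arm containing a vertex; vertices outside the arms get the junk value `false`. -/
def arm : Vertex k s r m → Bool
  | .inl none => false
  | .inl (some (.inl (_, a, _))) => a
  | .inl (some (.inr _)) => false
  | .inr l => decide ((l % (2 * k)) % 2 = 1)

/-- The height of a vertex above the leaves: arms occupy the heights from `1` to `s`, trunks those
from `s + 1` to `s + r`, and the centre has height `s + r + 1`. -/
def height : Vertex k s r m → ℕ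
  | .inl none => s + r + 1
  | .inl (some (.inl (_, _, y))) => y + 1
  | .inl (some (.inr (_, y))) => s + 1 + y
  | .inr _ => 0

/-- `v` is the parent of `u` in the tree rooted at the centre. -/
def IsParent (u v : Vertex k s r m) : Prop :=
  height v = height u + 1 ∧
    (height v = s + r + 1 ∨ (branch u = branch v ∧ (arm u = arm v ∨ s < height v)))

/-- The forked spider: the tree in which each vertex is joined to its parent, with the tops of the
trunks made pairwise adjacent if `odd` holds. Leaves of different branches are at distance
`2 * (s + r + 1)`, respectively `2 * (s + r) + 1` if `odd` holds. -/
def graph (k s r m : ℕ) (odd : Bool) : SimpleGraph (Vertex k s r m) :=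
  SimpleGraph.fromRel fun u v =>
    IsParent u v ∨ (odd = true ∧ height u = s + r ∧ height v = s + r)

/-- The diameter of the forked spider, provided that there are leaves in two branches. -/
def diameter (s r : ℕ) (odd : Bool) : ℕ := 2 * (s + r) + if odd then 1 else 2

variable {odd : Bool}

theorem height_le (v : Vertex k s r m) : height v ≤ s + r + 1 := by
  rcases v with (_ | ⟨b, a, y⟩ | ⟨b, y⟩) | l <;> simp only [height] <;> omega

theorem eq_centre_of_height_eq {v : Vertex k s r m} (h : height v = s + r + 1) :
    v = .inl none := by
  rcases v with (_ | ⟨b, a, y⟩ | ⟨b, y⟩) | l <;> simp only [height] at h ⊢ <;> omega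

theorem IsParent.adj {u v : Vertex k s r m} (h : IsParent u v) : (graph k s r m odd).Adj u v := by
  refine (SimpleGraph.fromRel_adj _ _ _).2 ⟨?_, .inl (.inl h)⟩
  rintro rfl
  have := h.1
  omega

theorem exists_isParent (hk : 0 < k) (hr : 0 < r) {v : Vertex k s r m} (hv : height v < s + r) :
    ∃ u, IsParent v u := by
  rcases v with (_ | ⟨b, a, y⟩ | ⟨b, y⟩) | l
  · simp only [height] at hv; omega
  · by_cases hy : y + 1 < s
    · exact ⟨.inl (some (.inl (b, a, ⟨y + 1, hy⟩))), ⟨rfl, .inr ⟨rfl, .inl rfl⟩⟩⟩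
    · refine ⟨.inl (some (.inr (b, ⟨0, hr⟩))), ⟨?_, .inr ⟨rfl, .inr ?_⟩⟩⟩ <;>
        simp only [height] <;> omega
  · simp only [height] at hv
    refine ⟨.inl (some (.inr (b, ⟨y + 1, by omega⟩))), ⟨?_, .inr ⟨rfl, .inr ?_⟩⟩⟩ <;>
      simp only [height] <;> omega
  · have hb : (l % (2 * k)) / 2 < k := by
      have := Nat.mod_lt (l : ℕ) (by omega : 0 < 2 * k)
      omega
    by_cases hs : 0 < s
    · exact ⟨.inl (some (.inl (⟨_, hb⟩, decide ((l % (2 * k)) % 2 = 1), ⟨0, hs⟩))),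
        ⟨rfl, .inr ⟨rfl, .inl rfl⟩⟩⟩
    · refine ⟨.inl (some (.inr (⟨_, hb⟩, ⟨0, hr⟩))), ⟨?_, .inr ⟨rfl, .inr ?_⟩⟩⟩ <;>
        simp only [height] <;> omega

theorem exists_walk_top (hk : 0 < k) (hr : 0 < r) (v : Vertex k s r m) (hv : height v ≤ s + r) :
    ∃ (t : Vertex k s r m) (p : (graph k s r m odd).Walk v t),
      height t = s + r ∧ p.length + height v = s + r := by
  induction hj : s + r - height v generalizing v with
  | zero => exact ⟨v, .nil, by omega, by simp; omega⟩
  | succ j ih =>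
    obtain ⟨u, hu⟩ := exists_isParent hk hr (v := v) (by omega)
    have h1 := hu.1
    obtain ⟨t, p, ht, hp⟩ := ih u (by omega) (by omega)
    exact ⟨t, .cons hu.adj p, ht, by rw [SimpleGraph.Walk.length_cons]; omega⟩

theorem exists_walk_centre (hk : 0 < k) (hr : 0 < r) (v : Vertex k s r m) :
    ∃ p : (graph k s r m odd).Walk v (.inl none), p.length ≤ s + r + 1 := by
  by_cases hv : height v ≤ s + r
  · obtain ⟨t, p, ht, hp⟩ := exists_walk_top (odd := odd) hk hr v hv
    have h : IsParent t (.inl none) := ⟨by rw [ht]; rfl, .inl rfl⟩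
    refine ⟨p.append (.cons h.adj .nil), ?_⟩
    simp only [SimpleGraph.Walk.length_append, SimpleGraph.Walk.length_cons,
      SimpleGraph.Walk.length_nil]
    omega
  · obtain rfl := eq_centre_of_height_eq (v := v) (by have := height_le v; omega)
    exact ⟨.nil, by simp⟩

theorem connected (hk : 0 < k) (hr : 0 < r) : (graph k s r m odd).Connected := by
  have : Nonempty (Vertex k s r m) := ⟨.inl none⟩
  refine ⟨fun u v => ?_⟩
  obtain ⟨p, -⟩ := exists_walk_centre (odd := odd) hk hr u
  obtain ⟨q, -⟩ := exists_walk_centre (odd := odd) hk hr v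
  exact ⟨p.append q.reverse⟩

theorem dist_le_diameter (hk : 0 < k) (hr : 0 < r) (u v : Vertex k s r m) :
    (graph k s r m odd).dist u v ≤ diameter s r odd := by
  have hG := connected (s := s) (m := m) (odd := odd) hk hr
  have hcentre : ∀ w : Vertex k s r m, (graph k s r m odd).dist w (.inl none) ≤ s + r + 1 := by
    intro w
    obtain ⟨p, hp⟩ := exists_walk_centre (odd := odd) hk hr w
    exact (SimpleGraph.dist_le p).trans hp
  cases odd with
  | false =>
    have h1 := hG.dist_triangle (u := u) (v := .inl none) (w := v)
    have h2 := hcentre v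
    rw [SimpleGraph.dist_comm] at h2
    have h3 := hcentre u
    simp only [diameter, Bool.false_eq_true, if_false]
    omega
  | true =>
    simp only [diameter, if_true]
    by_cases hu : height u ≤ s + r
    · by_cases hv : height v ≤ s + r
      · obtain ⟨t, p, ht, hp⟩ := exists_walk_top (odd := true) hk hr u hu
        obtain ⟨t', q, ht', hq⟩ := exists_walk_top (odd := true) hk hr v hv
        have h1 : (graph k s r m true).dist t t' ≤ 1 := by
          by_cases htt : t = t'
          · simp [htt]
          · refine (SimpleGraph.dist_eq_one_iff_adj.2 ?_).le
            exact (SimpleGraph.fromRel_adj _ _ _).2 ⟨htt, .inl (.inr ⟨rfl, ht, ht'⟩)⟩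
        have h2 := hG.dist_triangle (u := u) (v := t) (w := v)
        have h3 := hG.dist_triangle (u := t) (v := t') (w := v)
        have h4 := SimpleGraph.dist_le p
        have h5 := SimpleGraph.dist_le q.reverse
        rw [SimpleGraph.Walk.length_reverse] at h5
        omega
      · obtain rfl := eq_centre_of_height_eq (v := v) (by have := height_le v; omega)
        have := hcentre u
        omega
    · obtain rfl := eq_centre_of_height_eq (v := u) (by have := height_le u; omega)
      have := hcentre v
      rw [SimpleGraph.dist_comm] at this
      omega

/-- A lower bound for the distance of the vertex `v` from a leaf in branch `b` and arm `a`. It is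
`0` at every leaf of that arm, although two leaves of one arm are at distance `2`. -/
def distFromLeaf (odd : Bool) (b : ℕ) (a : Bool) (v : Vertex k s r m) : ℕ :=
  if height v = s + r + 1 then s + r + 1
  else if branch v = b then
    if arm v = a ∨ s < height v then height v else 2 * (s + 1) - height v
  else diameter s r odd - height v

theorem distFromLeaf_isParent (b : ℕ) (a : Bool) {u v : Vertex k s r m} (h : IsParent u v) :
    distFromLeaf odd b a v ≤ distFromLeaf odd b a u + 1 ∧
      distFromLeaf odd b a u ≤ distFromLeaf odd b a v + 1 := by
  obtain ⟨h1, h2⟩ := h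
  have h3 := height_le v
  have h4 := height_le u
  simp only [distFromLeaf, diameter]
  cases odd <;> grind

theorem distFromLeaf_adj (hr : 0 < r) (b : ℕ) (a : Bool) {u v : Vertex k s r m}
    (h : (graph k s r m odd).Adj u v) :
    distFromLeaf odd b a v ≤ distFromLeaf odd b a u + 1 := by
  obtain ⟨-, (h | ⟨ho, hu, hv⟩) | (h | ⟨ho, hv, hu⟩)⟩ := (SimpleGraph.fromRel_adj _ _ _).1 h
  · exact (distFromLeaf_isParent b a h).1
  · simp only [distFromLeaf, diameter, hu, hv, ho, if_true]
    grind
  · exact (distFromLeaf_isParent b a h).2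
  · simp only [distFromLeaf, diameter, hu, hv, ho, if_true]
    grind

theorem distFromLeaf_le_dist (hk : 0 < k) (hr : 0 < r) (l : Fin m) (v : Vertex k s r m) :
    distFromLeaf odd (branch (.inr l : Vertex k s r m)) (arm (.inr l : Vertex k s r m)) v ≤
      (graph k s r m odd).dist (.inr l) v := by
  have h := (connected hk hr).le_add_dist_of_forall_adj
    (fun u v h => distFromLeaf_adj (odd := odd) hr
      (branch (.inr l : Vertex k s r m)) (arm (.inr l : Vertex k s r m)) h) (.inr l) v
  have h0 : distFromLeaf odd (branch (.inr l : Vertex k s r m)) (arm (.inr l : Vertex k s r m))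
      (.inr l : Vertex k s r m) = 0 := by
    simp [distFromLeaf, height]
  omega

/-! ### The deficit of the forked spider -/

theorem card_skeleton : Fintype.card (Skeleton k s r) = k * (2 * s + r) + 1 := by
  simp only [Fintype.card_option, Fintype.card_sum, Fintype.card_prod, Fintype.card_fin,
    Fintype.card_bool]
  ring

theorem card_filter_mod_eq_le (q c : ℕ) :
    (((Finset.univ.filter fun l : Fin m => (l : ℕ) % q = c).card : ℕ) : ℝ) ≤ m / q + 1 := by
  have h1 : (Finset.univ.filter fun l : Fin m => (l : ℕ) % q = c).card ≤ m / q + 1 := by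
    rw [← Finset.card_range (m / q + 1)]
    refine Finset.card_le_card_of_injOn (fun l => (l : ℕ) / q) (fun l _ => ?_) ?_
    · simp only [Finset.coe_range, Set.mem_Iio, Nat.lt_succ_iff]
      exact Nat.div_le_div_right l.2.le
    · intro l hl l' hl' h
      simp only [Finset.coe_filter, Finset.mem_univ, true_and, Set.mem_ofPred_eq] at hl hl' h
      rw [Fin.ext_iff, ← Nat.div_add_mod (l : ℕ) q, ← Nat.div_add_mod (l' : ℕ) q, h, hl, hl']
  calc _ ≤ ((m / q + 1 : ℕ) : ℝ) := by exact_mod_cast h1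
    _ ≤ m / q + 1 := by push_cast; gcongr; exact Nat.cast_div_le

/-- The sum of the heights of the vertices of the skeleton. -/
noncomputable def heightSum (k s r : ℕ) : ℝ :=
  (s + r + 1) + k * (s * (s + 1) + r * s + (r ^ 2 + r) / 2)

theorem sum_height_skeleton :
    ∑ x : Skeleton k s r, (height (.inl x : Vertex k s r m) : ℝ) = heightSum k s r := by
  have h1 : ∀ n : ℕ, ∑ y : Fin n, ((y : ℕ) : ℝ) = n * (n - 1) / 2 := by
    intro n
    rw [Fin.sum_univ_eq_sum_range (fun i => (i : ℝ))]
    induction n with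
    | zero => simp
    | succ n ih => rw [Finset.sum_range_succ, ih]; push_cast; ring
  simp only [Fintype.sum_option, Fintype.sum_sum_type, Fintype.sum_prod_type, height, heightSum,
    Nat.cast_add, Nat.cast_one, Finset.sum_add_distrib, h1, Finset.sum_const, Finset.card_univ,
    Fintype.card_prod, Fintype.card_fin, Fintype.card_bool, nsmul_eq_mul]
  push_cast
  ring

theorem branch_leaf_lt (hk : 0 < k) (l : Fin m) : branch (.inr l : Vertex k s r m) < k := by
  have := Nat.mod_lt (l : ℕ) (by omega : 0 < 2 * k)
  simp only [branch]
  omega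

/-- The pairs formed by a leaf and a vertex of the skeleton in another branch have deficit at most
the height of the latter. -/
theorem sum_leaf_skeleton_le (hk : 0 < k) (hr : 0 < r) (l : Fin m) :
    ∑ x : Skeleton k s r,
        ((diameter s r odd : ℝ) - (graph k s r m odd).dist (.inr l) (.inl x)) ≤
      heightSum k s r + diameter s r odd * (1 + 2 * s + r) := by
  set D : ℝ := (diameter s r odd : ℝ) with hD
  have hD0 : 0 ≤ D := by positivity
  set B : Fin k := ⟨branch (.inr l : Vertex k s r m), branch_leaf_lt hk l⟩ with hB
  let ind : Skeleton k s r → ℝ := fun x => match x with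
    | none => D
    | some (.inl (b, _, _)) => if b = B then D else 0
    | some (.inr (b, _)) => if b = B then D else 0
  have hpt : ∀ x : Skeleton k s r, D - (graph k s r m odd).dist (.inr l) (.inl x) ≤
      height (.inl x : Vertex k s r m) + ind x := by
    have htriv : ∀ x : Skeleton k s r, ind x = D →
        D - (graph k s r m odd).dist (.inr l) (.inl x) ≤
          height (.inl x : Vertex k s r m) + ind x := by
      intro x hx
      rw [hx]
      have h1 : (0 : ℝ) ≤ (graph k s r m odd).dist (.inr l) (.inl x) := by positivity
      have h2 : (0 : ℝ) ≤ height (.inl x : Vertex k s r m) := by positivity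
      linarith
    have hother : ∀ x : Skeleton k s r,
        height (.inl x : Vertex k s r m) ≤ s + r →
        branch (.inl x : Vertex k s r m) ≠ branch (.inr l : Vertex k s r m) → ind x = 0 →
        D - (graph k s r m odd).dist (.inr l) (.inl x) ≤
          height (.inl x : Vertex k s r m) + ind x := by
      intro x hx hb hi
      have h := distFromLeaf_le_dist (odd := odd) hk hr l (.inl x)
      rw [distFromLeaf, if_neg (by omega), if_neg hb] at h
      have h2 : diameter s r odd ≤
          height (.inl x : Vertex k s r m) + (graph k s r m odd).dist (.inr l) (.inl x) := by
        omega
      have h3 : D ≤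
          height (.inl x : Vertex k s r m) + (graph k s r m odd).dist (.inr l) (.inl x) := by
        rw [hD]
        exact_mod_cast h2
      rw [hi]
      linarith
    intro x
    rcases x with _ | ⟨b, a, y⟩ | ⟨b, y⟩
    · exact htriv _ rfl
    · by_cases hb : b = B
      · exact htriv _ (if_pos hb)
      · exact hother _ (by simp only [height]; omega) (fun h => hb (Fin.ext h)) (if_neg hb)
    · by_cases hb : b = B
      · exact htriv _ (if_pos hb)
      · exact hother _ (by simp only [height]; omega) (fun h => hb (Fin.ext h)) (if_neg hb)
  refine (Finset.sum_le_sum fun x _ => hpt x).trans ?_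
  rw [Finset.sum_add_distrib, sum_height_skeleton]
  gcongr
  apply le_of_eq
  have h0 : ind none = D := rfl
  have h1 : ∀ b a y, ind (some (.inl (b, a, y))) = if b = B then D else 0 := fun _ _ _ => rfl
  have h2 : ∀ b y, ind (some (.inr (b, y))) = if b = B then D else 0 := fun _ _ => rfl
  clear_value ind
  have h3 : ∀ c : ℝ, ∑ b : Fin k, c * (if b = B then D else 0) = c * D := fun c => by
    rw [← Finset.mul_sum, Finset.sum_ite_eq' Finset.univ B, if_pos (Finset.mem_univ B)]
  have h4 : ∀ b : Fin k, ∑ p : Bool × Fin s, ind (some (.inl (b, p))) =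
      2 * s * (if b = B then D else 0) := fun b => by
    rw [Finset.sum_congr rfl (fun p _ => h1 b p.1 p.2), Finset.sum_const, nsmul_eq_mul,
      Finset.card_univ, Fintype.card_prod, Fintype.card_bool, Fintype.card_fin]
    push_cast
    ring
  have h5 : ∀ b : Fin k, ∑ y : Fin r, ind (some (.inr (b, y))) =
      r * (if b = B then D else 0) := fun b => by
    rw [Finset.sum_congr rfl fun y _ => h2 b y, Finset.sum_const, nsmul_eq_mul,
      Finset.card_univ, Fintype.card_fin]
  rw [Fintype.sum_option, Fintype.sum_sum_type, Fintype.sum_prod_type, Fintype.sum_prod_type,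
    Finset.sum_congr rfl fun b _ => h4 b, Finset.sum_congr rfl fun b _ => h5 b, h3, h3, h0]
  ring

/-- Leaves of different branches have no deficit, and leaves of different arms of one branch have
distance at least `2 * (s + 1)`. -/
theorem sum_leaf_leaf_le (hk : 0 < k) (hr : 0 < r) (l : Fin m) :
    ∑ l' : Fin m, ((diameter s r odd : ℝ) - (graph k s r m odd).dist (.inr l) (.inr l')) ≤
      ((m : ℝ) / (2 * k) + 1) * (2 * diameter s r odd - 2 * (s + 1)) := by
  set D : ℝ := (diameter s r odd : ℝ) with hD
  have hDs : (0 : ℝ) ≤ D - 2 * (s + 1) := by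
    have : 2 * (s + 1) ≤ diameter s r odd := by simp only [diameter]; omega
    have : (2 * (s + 1) : ℝ) ≤ D := by rw [hD]; exact_mod_cast this
    linarith
  have hD0 : 0 ≤ D := by positivity
  set q := 2 * k with hq
  set c := (l : ℕ) % q with hc
  -- The residue class of the other arm of the branch.
  set c' := 4 * (c / 2) + 1 - c with hc'
  have hpt : ∀ l' : Fin m, D - (graph k s r m odd).dist (.inr l) (.inr l') ≤
      (if (l' : ℕ) % q = c then D else 0) +
        (if (l' : ℕ) % q = c' then D - 2 * (s + 1) else 0) := by
    intro l'
    have h := distFromLeaf_le_dist (s := s) (odd := odd) hk hr l (.inr l')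
    have hdnn : (0 : ℝ) ≤ (graph k s r m odd).dist (.inr l) (.inr l') := by positivity
    by_cases h1 : (l' : ℕ) % q = c
    · have : (0 : ℝ) ≤ (if (l' : ℕ) % q = c' then D - 2 * (s + 1) else 0) := by
        split_ifs
        · exact hDs
        · exact le_rfl
      rw [if_pos h1]
      linarith
    rw [if_neg h1, zero_add]
    rw [distFromLeaf, if_neg (by simp only [height]; omega)] at h
    by_cases h2 : (l' : ℕ) % q = c'
    · rw [if_pos h2]
      rw [if_pos (by simp only [branch, ← hq, ← hc]; omega), if_neg ?_] at h
      · have h3 : 2 * (s + 1) ≤ (graph k s r m odd).dist (.inr l) (.inr l') := by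
          simpa [height] using h
        have h3 : (2 * (s + 1) : ℝ) ≤ (graph k s r m odd).dist (.inr l) (.inr l') := by
          exact_mod_cast h3
        linarith
      · simp only [arm, height, ← hq, ← hc, decide_eq_decide]
        omega
    · rw [if_neg h2]
      rw [if_neg (by simp only [branch, ← hq, ← hc]; omega)] at h
      have h3 : diameter s r odd ≤ (graph k s r m odd).dist (.inr l) (.inr l') := by
        simpa [height] using h
      have h3 : D ≤ (graph k s r m odd).dist (.inr l) (.inr l') := by
        rw [hD]
        exact_mod_cast h3
      linarith
  refine (Finset.sum_le_sum fun l' _ => hpt l').trans ?_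
  rw [Finset.sum_add_distrib, ← Finset.sum_filter, ← Finset.sum_filter, Finset.sum_const,
    Finset.sum_const, nsmul_eq_mul, nsmul_eq_mul]
  have e1 := mul_le_mul_of_nonneg_right (card_filter_mod_eq_le (m := m) q c) hD0
  have e2 := mul_le_mul_of_nonneg_right (card_filter_mod_eq_le (m := m) q c') hDs
  have hqc : (q : ℝ) = 2 * k := by rw [hq]; push_cast; rfl
  rw [hqc] at e1 e2
  linarith

theorem totalDeficit_le (hk : 0 < k) (hr : 0 < r) :
    (graph k s r m odd).totalDeficit (diameter s r odd) ≤
      diameter s r odd * ((k : ℝ) * (2 * s + r) + 1) ^ 2 +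
        2 * m * (heightSum k s r + diameter s r odd * (1 + 2 * s + r)) +
          m * (((m : ℝ) / (2 * k) + 1) * (2 * diameter s r odd - 2 * (s + 1))) := by
  have hSS : ∑ x : Skeleton k s r, ∑ x' : Skeleton k s r,
      ((diameter s r odd : ℝ) - (graph k s r m odd).dist (.inl x) (.inl x')) ≤
        diameter s r odd * ((k : ℝ) * (2 * s + r) + 1) ^ 2 := by
    have : ∑ x : Skeleton k s r, ∑ x' : Skeleton k s r,
      ((diameter s r odd : ℝ) - (graph k s r m odd).dist (.inl x) (.inl x')) ≤
        ∑ x : Skeleton k s r, ∑ x' : Skeleton k s r, (diameter s r odd : ℝ) := by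
      refine Finset.sum_le_sum fun x _ => Finset.sum_le_sum fun x' _ => ?_
      simp
    refine this.trans (le_of_eq ?_)
    rw [Finset.sum_const, Finset.sum_const, Finset.card_univ, card_skeleton, nsmul_eq_mul,
      nsmul_eq_mul]
    push_cast
    ring
  have hSL := Finset.sum_le_sum fun (l : Fin m) (_ : l ∈ Finset.univ) =>
    sum_leaf_skeleton_le (s := s) (odd := odd) hk hr l
  have hLL := Finset.sum_le_sum fun (l : Fin m) (_ : l ∈ Finset.univ) =>
    sum_leaf_leaf_le (s := s) (odd := odd) hk hr l
  rw [Finset.sum_const, Finset.card_univ, Fintype.card_fin, nsmul_eq_mul] at hSL hLL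
  have hLS : ∑ x : Skeleton k s r, ∑ l : Fin m,
      ((diameter s r odd : ℝ) - (graph k s r m odd).dist (.inl x) (.inr l)) =
        ∑ l : Fin m, ∑ x : Skeleton k s r,
          ((diameter s r odd : ℝ) - (graph k s r m odd).dist (.inr l) (.inl x)) := by
    rw [Finset.sum_comm]
    refine Finset.sum_congr rfl fun l _ => Finset.sum_congr rfl fun x _ => ?_
    rw [SimpleGraph.dist_comm]
  simp only [SimpleGraph.totalDeficit, SimpleGraph.deficit, Fintype.sum_sum_type,
    Finset.sum_add_distrib]
  linarith

theorem exists_diameter_le_dist (hk : 2 ≤ k) (hr : 0 < r) (hm : 3 ≤ m) :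
    ∃ u v, diameter s r odd ≤ (graph k s r m odd).dist u v := by
  refine ⟨.inr ⟨0, by omega⟩, .inr ⟨2, by omega⟩, ?_⟩
  have h := distFromLeaf_le_dist (s := s) (odd := odd) (by omega : 0 < k) hr (⟨0, by omega⟩ : Fin m)
    (.inr ⟨2, by omega⟩)
  have h2 : 2 % (2 * k) = 2 := Nat.mod_eq_of_lt (by omega)
  rw [distFromLeaf, if_neg (by simp only [height]; omega), if_neg (by simp [branch, h2])] at h
  simpa [height] using h

theorem exists_mem_wienerValues {n : ℕ} (hk : 2 ≤ k) (hr : 0 < r)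
    (hn : k * (2 * s + r) + 4 ≤ n) :
    ∃ w ∈ wienerValues n (diameter s r odd),
      (diameter s r odd : ℝ) * (n : ℝ) ^ 2 - 2 * w ≤
        diameter s r odd * ((k : ℝ) * (2 * s + r) + 1) ^ 2 +
          2 * n * (heightSum k s r + diameter s r odd * (1 + 2 * s + r)) +
            n * (((n : ℝ) / (2 * k) + 1) * (2 * diameter s r odd - 2 * (s + 1))) := by
  obtain ⟨m, rfl⟩ : ∃ m, n = k * (2 * s + r) + 1 + m := ⟨n - (k * (2 * s + r) + 1), by omega⟩
  obtain ⟨w, hw, hwd⟩ := exists_mem_wienerValues_of_card_eq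
    (n := k * (2 * s + r) + 1 + m) (d := diameter s r odd)
    (by rw [Fintype.card_sum, card_skeleton, Fintype.card_fin]) (graph k s r m odd)
    (connected (by omega) hr) (dist_le_diameter (by omega) hr)
    (exists_diameter_le_dist hk hr (by omega))
  refine ⟨w, hw, ?_⟩
  rw [hwd]
  refine (totalDeficit_le (by omega) hr).trans ?_
  have hmn : (m : ℝ) ≤ ((k * (2 * s + r) + 1 + m : ℕ) : ℝ) := by
    exact_mod_cast Nat.le_add_left _ _
  have hDs : (0 : ℝ) ≤ 2 * diameter s r odd - 2 * (s + 1) := by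
    have : s + 1 ≤ diameter s r odd := by simp only [diameter]; omega
    have : (s + 1 : ℝ) ≤ diameter s r odd := by exact_mod_cast this
    linarith
  have hh : 0 ≤ heightSum k s r := by unfold heightSum; positivity
  gcongr

end ForkedSpider

/-! ### Asymptotics -/

theorem Real.rpow_three_halves_eq_sqrt_pow {x : ℝ} (hx : 0 ≤ x) :
    x ^ (3 / 2 : ℝ) = Real.sqrt x ^ 3 := by
  rw [Real.sqrt_eq_rpow, ← Real.rpow_natCast, ← Real.rpow_mul hx]
  norm_num

theorem tendsto_inv_sqrt_natCast : Tendsto (fun n : ℕ => 1 / Real.sqrt n) atTop (𝓝 0) :=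
  tendsto_const_nhds.div_atTop (Real.tendsto_sqrt_atTop.comp tendsto_natCast_atTop_atTop)

theorem wienerGap_eq (n d : ℕ) :
    wienerGap n d = ((d : ℝ) * (n : ℝ) ^ 2 - 2 * maxWiener n d) /
      (2 * Real.sqrt d ^ 3 * Real.sqrt n ^ 3) := by
  rw [wienerGap, Real.rpow_three_halves_eq_sqrt_pow (by positivity),
    Real.rpow_three_halves_eq_sqrt_pow (by positivity)]
  field_simp

theorem geodesicConst_mul_pow_le_maxWiener {n d : ℕ} (hd : 0 < d) (hdn : d ≤ n) :
    0 ≤ (d : ℝ) * (n : ℝ) ^ 2 - 2 * maxWiener n d ∧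
      SimpleGraph.geodesicConst d * (n : ℝ) ^ 3 ≤
        ((d : ℝ) * (n : ℝ) ^ 2 - 2 * maxWiener n d) *
          ((d : ℝ) * (n : ℝ) ^ 2 - 2 * maxWiener n d +
            2 * SimpleGraph.geodesicConst d * n / d) := by
  have hd0 : (0 : ℝ) < d := by exact_mod_cast hd
  rcases (wienerValues n d).eq_empty_or_nonempty with h | h
  · -- Without graphs of order `n` and diameter `d`, `maxWiener n d` has the junk value `0`.
    have h0 : maxWiener n d = 0 := by simp [maxWiener, h]
    rw [h0]
    simp only [Nat.cast_zero, mul_zero, sub_zero]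
    refine ⟨by positivity, ?_⟩
    have hc := SimpleGraph.geodesicConst_nonneg d
    have hdn' : (d : ℝ) ≤ n := by exact_mod_cast hdn
    calc SimpleGraph.geodesicConst d * (n : ℝ) ^ 3
        ≤ (d : ℝ) ^ 3 * (n : ℝ) ^ 3 := by gcongr; exact SimpleGraph.geodesicConst_le d
      _ = (d : ℝ) ^ 2 * d * (n : ℝ) ^ 3 := by ring
      _ ≤ (d : ℝ) ^ 2 * n * (n : ℝ) ^ 3 := by gcongr
      _ = (d : ℝ) * (n : ℝ) ^ 2 * ((d : ℝ) * (n : ℝ) ^ 2 + 0) := by ring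
      _ ≤ _ := by gcongr; positivity
  · obtain ⟨G, hG, hGd, hGw⟩ := (isGreatest_maxWiener h).1
    have hdist : ∀ u v, G.dist u v ≤ d := by
      intro u v
      have := hG.nonempty
      rw [← hGd]
      exact SimpleGraph.dist_le_diam (SimpleGraph.connected_iff_ediam_ne_top.1 hG)
    rw [← hGw, ← SimpleGraph.totalDeficit_eq_sub_wienerIndex]
    refine ⟨Finset.sum_nonneg fun v _ => (SimpleGraph.deficit_pos hd hdist v).le, ?_⟩
    have := SimpleGraph.geodesicConst_mul_card_pow_le hG hd hdist
    rwa [Fintype.card_fin] at this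

theorem le_wienerGap {n d : ℕ} (hd : 0 < d) (hdn : d ≤ n) :
    Real.sqrt (SimpleGraph.geodesicConst d) / (2 * Real.sqrt d ^ 3) -
        SimpleGraph.geodesicConst d / (d * Real.sqrt d ^ 3) * (1 / Real.sqrt n) ≤
      wienerGap n d := by
  obtain ⟨h0, h1⟩ := geodesicConst_mul_pow_le_maxWiener hd hdn
  rw [wienerGap_eq]
  set T := (d : ℝ) * (n : ℝ) ^ 2 - 2 * maxWiener n d
  set c := SimpleGraph.geodesicConst d
  have hc : 0 ≤ c := SimpleGraph.geodesicConst_nonneg d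
  have hd0 : (0 : ℝ) < d := by exact_mod_cast hd
  have hn0 : (0 : ℝ) < n := by exact_mod_cast hd.trans_le hdn
  have hp : 0 < Real.sqrt d := Real.sqrt_pos.2 hd0
  have hq : 0 < Real.sqrt n := Real.sqrt_pos.2 hn0
  have hqq : (n : ℝ) = Real.sqrt n ^ 2 := (Real.sq_sqrt hn0.le).symm
  set q := Real.sqrt n
  have hδ : 0 ≤ 2 * c * n / d := by positivity
  have h2 : Real.sqrt c * q ^ 3 ≤ T + 2 * c * n / d := by
    refine le_of_sq_le_sq ?_ (by positivity)
    calc (Real.sqrt c * q ^ 3) ^ 2 = c * (n : ℝ) ^ 3 := by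
          rw [mul_pow, Real.sq_sqrt hc, hqq]; ring
      _ ≤ T * (T + 2 * c * n / d) := h1
      _ ≤ (T + 2 * c * n / d) ^ 2 := by nlinarith
  rw [le_div_iff₀ (by positivity)]
  have h3 : (Real.sqrt c / (2 * Real.sqrt d ^ 3) - c / (d * Real.sqrt d ^ 3) * (1 / q)) *
      (2 * Real.sqrt d ^ 3 * q ^ 3) = Real.sqrt c * q ^ 3 - 2 * c * q ^ 2 / d := by
    field_simp
  rw [h3, ← hqq]
  linarith

theorem le_liminf_wienerGap {d : ℕ} (hd : 0 < d) :
    ((Real.sqrt (SimpleGraph.geodesicConst d) / (2 * Real.sqrt d ^ 3) : ℝ) : EReal) ≤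
      liminf (fun n : ℕ => (wienerGap n d : EReal)) atTop := by
  have h : Tendsto (fun n : ℕ => Real.sqrt (SimpleGraph.geodesicConst d) / (2 * Real.sqrt d ^ 3) -
        SimpleGraph.geodesicConst d / (d * Real.sqrt d ^ 3) * (1 / Real.sqrt n)) atTop
      (𝓝 (Real.sqrt (SimpleGraph.geodesicConst d) / (2 * Real.sqrt d ^ 3))) := by
    simpa using tendsto_const_nhds.sub (tendsto_inv_sqrt_natCast.const_mul
      (SimpleGraph.geodesicConst d / (d * Real.sqrt d ^ 3)))
  have h' := (continuous_coe_real_ereal.tendsto _).comp h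
  rw [← h'.liminf_eq]
  refine liminf_le_liminf ?_
  filter_upwards [eventually_ge_atTop d] with n hn
  exact EReal.coe_le_coe_iff.2 (le_wienerGap hd hn)

theorem le_liminf_liminf_wienerGap :
    ((1 / (2 * Real.sqrt 24) : ℝ) : EReal) ≤
      liminf (fun d : ℕ => liminf (fun n : ℕ => (wienerGap n d : EReal)) atTop) atTop := by
  have h : Tendsto (fun d : ℕ => Real.sqrt ((1 - 4 * (1 / Real.sqrt d) ^ 4) / 24) / 2) atTop
      (𝓝 (1 / (2 * Real.sqrt 24))) := by
    have h1 : Tendsto (fun d : ℕ => (1 - 4 * (1 / Real.sqrt d) ^ 4) / 24) atTop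
        (𝓝 ((1 - 4 * 0 ^ 4) / 24)) :=
      (((tendsto_inv_sqrt_natCast.pow 4).const_mul 4).const_sub 1).div_const 24
    have h2 := ((Real.continuous_sqrt.tendsto _).comp h1).div_const 2
    have h3 : Real.sqrt ((1 - 4 * 0 ^ 4) / 24) / 2 = 1 / (2 * Real.sqrt 24) := by
      rw [show ((1 : ℝ) - 4 * 0 ^ 4) / 24 = 1 / 24 by norm_num, Real.sqrt_div zero_le_one,
        Real.sqrt_one]
      ring
    rwa [h3] at h2
  have h' := (continuous_coe_real_ereal.tendsto _).comp h
  rw [← h'.liminf_eq]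
  refine liminf_le_liminf ?_
  filter_upwards [eventually_gt_atTop 0] with d hd
  refine le_trans (EReal.coe_le_coe_iff.2 ?_) (le_liminf_wienerGap hd)
  have hd0 : (0 : ℝ) < d := by exact_mod_cast hd
  have hp : 0 < Real.sqrt d := Real.sqrt_pos.2 hd0
  have hpp : (d : ℝ) = Real.sqrt d ^ 2 := (Real.sq_sqrt hd0.le).symm
  have hc := SimpleGraph.geodesicConst_ge d
  set p := Real.sqrt d
  have h1 : Real.sqrt (SimpleGraph.geodesicConst d) / (2 * p ^ 3) =
      Real.sqrt (SimpleGraph.geodesicConst d / (p ^ 3) ^ 2) / 2 := by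
    rw [Real.sqrt_div' _ (by positivity), Real.sqrt_sq (by positivity)]
    field_simp
  rw [h1]
  refine div_le_div_of_nonneg_right (Real.sqrt_le_sqrt ?_) zero_le_two
  rw [le_div_iff₀ (by positivity)]
  refine le_trans (le_of_eq ?_) hc
  rw [hpp, Real.sqrt_sq hp.le]
  field_simp

theorem one_tenth_lt_one_div : (0.1 : ℝ) < 1 / (2 * Real.sqrt 24) := by
  have h : Real.sqrt 24 < 5 := by
    rw [Real.sqrt_lt' (by norm_num)]
    norm_num
  rw [lt_div_iff₀ (by positivity)]
  linarith

/-- The bound on the gap given by forked spiders with about `κ * √n` branches. -/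
theorem limsup_wienerGap_le {s r : ℕ} (hr : 0 < r) (odd : Bool) {κ : ℝ} (hκ : 0 < κ) :
    limsup (fun n : ℕ => (wienerGap n (ForkedSpider.diameter s r odd) : EReal)) atTop ≤
      (((2 * κ * (s * (s + 1) + r * s + (r ^ 2 + r) / 2) +
        (ForkedSpider.diameter s r odd - (s + 1)) / κ) /
          (2 * Real.sqrt (ForkedSpider.diameter s r odd) ^ 3) : ℝ) : EReal) := by
  set d := ForkedSpider.diameter s r odd with hd
  have hd0 : (0 : ℝ) < d := by
    have : 0 < d := by rw [hd, ForkedSpider.diameter]; omega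
    exact_mod_cast this
  have hp : 0 < Real.sqrt d := Real.sqrt_pos.2 hd0
  let k : ℕ → ℕ := fun n => ⌈κ * Real.sqrt n⌉₊
  have hz := tendsto_inv_sqrt_natCast
  have hsqrt : Tendsto (fun n : ℕ => Real.sqrt n) atTop atTop :=
    Real.tendsto_sqrt_atTop.comp tendsto_natCast_atTop_atTop
  have hk : Tendsto (fun n : ℕ => (k n : ℝ) / Real.sqrt n) atTop (𝓝 κ) :=
    (tendsto_nat_ceil_mul_div_atTop hκ.le).comp hsqrt
  have hk2 : ∀ᶠ n in atTop, 2 ≤ k n := by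
    filter_upwards [hsqrt.eventually_ge_atTop (2 / κ)] with n hn
    rw [div_le_iff₀ hκ] at hn
    have : (2 : ℝ) ≤ k n := by
      refine le_trans ?_ (Nat.le_ceil _)
      linarith
    exact_mod_cast this
  have hkn : ∀ᶠ n in atTop, k n * (2 * s + r) + 4 ≤ n := by
    have h : Tendsto (fun n : ℕ => (k n : ℝ) / Real.sqrt n * (2 * s + r) * (1 / Real.sqrt n) +
        4 * (1 / Real.sqrt n) ^ 2) atTop (𝓝 (κ * (2 * s + r) * 0 + 4 * 0 ^ 2)) :=
      ((hk.mul_const _).mul hz).add ((hz.pow 2).const_mul 4)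
    have h0 : κ * (2 * s + r) * 0 + 4 * 0 ^ 2 < 1 := by norm_num
    filter_upwards [h.eventually_lt_const h0, eventually_gt_atTop 0] with n hn hn0
    have hn0 : (0 : ℝ) < n := by exact_mod_cast hn0
    have hq : 0 < Real.sqrt n := Real.sqrt_pos.2 hn0
    have hqq : Real.sqrt n ^ 2 = n := Real.sq_sqrt hn0.le
    have h2 : (k n : ℝ) / Real.sqrt n * (2 * s + r) * (1 / Real.sqrt n) +
        4 * (1 / Real.sqrt n) ^ 2 = (k n * (2 * s + r) + 4) / Real.sqrt n ^ 2 := by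
      field_simp
    rw [h2, hqq, div_lt_one hn0] at hn
    exact_mod_cast hn.le
  have hF : Tendsto (fun n : ℕ =>
      (d * ((k n : ℝ) / Real.sqrt n * (2 * s + r) + 1 / Real.sqrt n) ^ 2 * (1 / Real.sqrt n) +
        2 * ((s + r + 1 + d * (1 + 2 * s + r)) * (1 / Real.sqrt n) +
          (k n : ℝ) / Real.sqrt n * (s * (s + 1) + r * s + (r ^ 2 + r) / 2)) +
        (1 / 2 * ((k n : ℝ) / Real.sqrt n)⁻¹ + 1 / Real.sqrt n) * (2 * d - 2 * (s + 1))) /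
          (2 * Real.sqrt d ^ 3)) atTop
      (𝓝 ((d * (κ * (2 * s + r) + 0) ^ 2 * 0 +
        2 * ((s + r + 1 + d * (1 + 2 * s + r)) * 0 +
          κ * (s * (s + 1) + r * s + (r ^ 2 + r) / 2)) +
        (1 / 2 * κ⁻¹ + 0) * (2 * d - 2 * (s + 1))) / (2 * Real.sqrt d ^ 3))) :=
    ((((((hk.mul_const _).add hz).pow 2).const_mul _).mul hz).add
      (((hz.const_mul _).add (hk.mul_const _)).const_mul 2) |>.add
      ((((hk.inv₀ hκ.ne').const_mul _).add hz).mul_const _)).div_const _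
  have hF' := (continuous_coe_real_ereal.tendsto _).comp hF
  have hval : (2 * κ * (s * (s + 1) + r * s + (r ^ 2 + r) / 2) + (d - (s + 1)) / κ) /
      (2 * Real.sqrt d ^ 3) = (d * (κ * (2 * s + r) + 0) ^ 2 * 0 +
        2 * ((s + r + 1 + d * (1 + 2 * s + r)) * 0 +
          κ * (s * (s + 1) + r * s + (r ^ 2 + r) / 2)) +
        (1 / 2 * κ⁻¹ + 0) * (2 * d - 2 * (s + 1))) / (2 * Real.sqrt d ^ 3) := by
    congr 1
    ring
  rw [hval, ← hF'.limsup_eq]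
  refine limsup_le_limsup ?_
  filter_upwards [hk2, hkn, eventually_gt_atTop 0] with n hkn2 hkn hn0
  refine EReal.coe_le_coe_iff.2 ?_
  have hn0 : (0 : ℝ) < n := by exact_mod_cast hn0
  have hq : 0 < Real.sqrt n := Real.sqrt_pos.2 hn0
  have hqq : (n : ℝ) = Real.sqrt n ^ 2 := (Real.sq_sqrt hn0.le).symm
  obtain ⟨w, hw, hle⟩ := ForkedSpider.exists_mem_wienerValues (odd := odd) hkn2 hr hkn
  have hmax : (w : ℝ) ≤ maxWiener n d := by
    exact_mod_cast (isGreatest_maxWiener ⟨w, hw⟩).2 hw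
  have hk0 : (0 : ℝ) < k n := by exact_mod_cast (by omega : 0 < k n)
  rw [wienerGap_eq]
  rw [← hd] at hle
  have hle' := (sub_le_sub_left (mul_le_mul_of_nonneg_left hmax zero_le_two) _).trans hle
  rw [div_le_iff₀ (by positivity)]
  refine hle'.trans (le_of_eq ?_)
  rw [ForkedSpider.heightSum, hqq, Real.sqrt_sq hq.le]
  field_simp
  ring

theorem limsup_limsup_wienerGap_lt :
    limsup (fun d : ℕ => limsup (fun n : ℕ => (wienerGap n d : EReal)) atTop) atTop <
      ((29 / 60 : ℝ) : EReal) := by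
  refine lt_of_le_of_lt ?_ (EReal.coe_lt_coe_iff.2 (by norm_num : (0.482 : ℝ) < 29 / 60))
  refine limsup_le_of_le (h := ?_)
  filter_upwards [eventually_ge_atTop 1000] with d hd
  -- Each branch forks at height about `d / 6`, that is, at a third of its length.
  set s := d / 6 with hs
  set r := (d - 1) / 2 - s with hr
  have hr0 : 0 < r := by omega
  obtain ⟨odd, hodd⟩ : ∃ odd : Bool, ForkedSpider.diameter s r odd = d := by
    rcases Nat.even_or_odd' d with ⟨m, hm | hm⟩
    · exact ⟨false, by simp only [ForkedSpider.diameter, Bool.false_eq_true, if_false]; omega⟩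
    · exact ⟨true, by simp only [ForkedSpider.diameter, if_true]; omega⟩
  have hd0 : (1000 : ℝ) ≤ d := by exact_mod_cast hd
  have hp : 0 < Real.sqrt d := Real.sqrt_pos.2 (by linarith)
  have hpp : Real.sqrt d ^ 2 = d := Real.sq_sqrt (by linarith)
  -- The best value of `κ` would be about `√3 / √d`; the rational number `7 / 4` replaces `√3`.
  have h := limsup_wienerGap_le (s := s) hr0 odd (κ := 7 / 4 / Real.sqrt d) (by positivity)
  rw [hodd] at h
  refine h.trans (EReal.coe_le_coe_iff.2 ?_)
  have h1 : (s : ℝ) ≤ d / 6 := by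
    have : (6 * s : ℝ) ≤ d := by exact_mod_cast (by omega : 6 * s ≤ d)
    linarith
  have h2 : (s : ℝ) + r ≤ d / 2 := by
    have : (2 * (s + r) : ℝ) ≤ d := by exact_mod_cast (by omega : 2 * (s + r) ≤ d)
    linarith
  have h3 : (d : ℝ) - (s + 1) ≤ 5 * d / 6 := by
    have : (d : ℝ) ≤ 6 * (s + 1) := by exact_mod_cast (by omega : d ≤ 6 * (s + 1))
    linarith
  have hs0 : (0 : ℝ) ≤ s := by positivity
  have hr0' : (0 : ℝ) ≤ r := by positivity
  have h4 : (s : ℝ) * (s + 1) + r * s + (r ^ 2 + r) / 2 ≤ 5 * d ^ 2 / 36 + d / 3 := by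
    have e1 : (s : ℝ) ^ 2 ≤ (d / 6) ^ 2 := by gcongr
    have e2 : ((s : ℝ) + r) ^ 2 ≤ (d / 2) ^ 2 := by gcongr
    nlinarith
  have h5 : (2 * (7 / 4 / Real.sqrt d) * (s * (s + 1) + r * s + (r ^ 2 + r) / 2) +
      (d - (s + 1)) / (7 / 4 / Real.sqrt d)) / (2 * Real.sqrt d ^ 3) =
      (7 / 4 * (s * (s + 1) + r * s + (r ^ 2 + r) / 2) +
        2 / 7 * (d - (s + 1)) * Real.sqrt d ^ 2) / (Real.sqrt d ^ 2) ^ 2 := by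
    field_simp
    ring
  rw [h5, hpp, div_le_iff₀ (by positivity)]
  nlinarith

/-- The lower and upper limits are taken in the extended reals, where they always exist. -/
theorem mainTheorem6 :
    (((1 / (2 * Real.sqrt 24) : ℝ) : EReal) ≤
        liminf (fun d : ℕ => liminf (fun n : ℕ => (wienerGap n d : EReal)) atTop) atTop ∧
      (0.1 : ℝ) < 1 / (2 * Real.sqrt 24)) ∧
    limsup (fun d : ℕ => limsup (fun n : ℕ => (wienerGap n d : EReal)) atTop) atTop <
      ((29 / 60 : ℝ) : EReal) :=
  ⟨⟨le_liminf_liminf_wienerGap, one_tenth_lt_one_div⟩, limsup_limsup_wienerGap_lt⟩
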